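/- Let $D\subset\mathbb{R}^d$, $d\ge 1$, be a bounded domain (open and connected) and let $Y=H^1_0(D)$ be the closure of $C_c^\infty(D)$ in $H^1(D)$, equipped with the norm $\|y\|_Y=\|\nabla y\|_{L^2(D)}$; let $Y^\star$ be its topological dual. Let $(\Omega,\mathcal{F},\mathbb{P})$ be a probability space and let $\kappa:\Omega\to C^0(\overline{D})$ be measurable, with $\kappa(\cdot,\omega)>0$ on $\overline{D}$ for almost every $\omega$, and such that for some $p\in[1,\infty]$ both $\kappa_{\max}(\omega)=\max_{x\in\overline D}\kappa(x,\omega)$ and $1/\kappa_{\min}(\omega)$, where $\kappa_{\min}(\omega)=\min_{x\in\overline D}\kappa(x,\omega)$, belong to $L^p(\Omega)$. Let $$a(u,v)=\mathbb{E}\Big[\int_D\kappa(x,\omega)\,\nabla u_\omega(x)\cdot\nabla v_\omega(x)\,dx\Big]$$ and let $H_{\mathcal A}$ be the energy space of all measurable $v:\Omega\to Y$, $\omega\mapsto v_\omega$ (up to almost sure equality), with $\|v\|_{\mathcal A}^2=a(v,v)<\infty$, equipped with the norm $\|\cdot\|_{\mathcal A}$; let $H_{\mathcal A}^\star$ be its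 topological dual. Put $$G=\{v\in H_{\mathcal A}:\ \mathbb{E}[v_\omega]=0\},\qquad G^0=\{F\in H_{\mathcal A}^\star:\ F(v)=0\ \text{for all } v\in G\}.$$ Then the operator $\mathcal{I}:Y^\star\to H_{\mathcal A}^\star$, $\langle\mathcal{I}f,v\rangle=\mathbb{E}[\langle f,v_\omega\rangle]$, is an isomorphism of $Y^\star$ onto $G^0$: it is a linear bijection from $Y^\star$ onto $G^0$, and it and its inverse are continuous. -/

import Mathlib

open MeasureTheory Set
open scoped ENNReal

/-- A bounded domain of `ℝ^d`: a bounded, connected (in particular nonempty), open set. -/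
structure BoundedDomain (d : ℕ) where
  carrier : Set (EuclideanSpace ℝ (Fin d))
  isOpen : IsOpen carrier
  isConnected : IsConnected carrier
  isBounded : Bornology.IsBounded carrier

namespace BoundedDomain

section Sobolev

variable {d : ℕ} (D : BoundedDomain d)

/-- The Lebesgue measure on the domain. -/
noncomputable abbrev leb : Measure (EuclideanSpace ℝ (Fin d)) :=
  (volume : Measure (EuclideanSpace ℝ (Fin d))).restrict D.carrier

/-- `L²(D)`. -/
noncomputable abbrev L2 : Type := Lp ℝ 2 D.leb

/-- `L²(D; ℝ^d)`. -/
noncomputable abbrev L2Vec : Type := Lp (EuclideanSpace ℝ (Fin d)) 2 D.leb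

/-- `φ ∈ C_c^∞(D)`. -/
structure IsTestFunction (φ : EuclideanSpace ℝ (Fin d) → ℝ) : Prop where
  contDiff : ContDiff ℝ (⊤ : ℕ∞) φ
  hasCompactSupport : HasCompactSupport φ
  tsupport_subset : tsupport φ ⊆ D.carrier

/-- `g` is the weak gradient of `u` on `D`: `∫_D u ∂ᵢφ = - ∫_D gᵢ φ` for all `φ ∈ C_c^∞(D)` and
all `i`. -/
def IsWeakGradient (u : D.L2) (g : D.L2Vec) : Prop :=
  ∀ φ : EuclideanSpace ℝ (Fin d) → ℝ, D.IsTestFunction φ → ∀ i : Fin d,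
    ∫ x in D.carrier, u x * fderiv ℝ φ x (EuclideanSpace.single i 1) =
      - ∫ x in D.carrier, g x i * φ x

variable {D}

theorem IsTestFunction.continuous {φ : EuclideanSpace ℝ (Fin d) → ℝ} (h : D.IsTestFunction φ) :
    Continuous φ := h.contDiff.continuous

theorem IsTestFunction.continuous_fderiv {φ : EuclideanSpace ℝ (Fin d) → ℝ}
    (h : D.IsTestFunction φ) : Continuous (fderiv ℝ φ) :=
  h.contDiff.continuous_fderiv (by simp)

theorem IsTestFunction.differentiable {φ : EuclideanSpace ℝ (Fin d) → ℝ}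
    (h : D.IsTestFunction φ) : Differentiable ℝ φ :=
  h.contDiff.differentiable (by simp)

theorem isWeakGradient_iff (u : D.L2) (g : D.L2Vec) : D.IsWeakGradient u g ↔
    ∀ φ : EuclideanSpace ℝ (Fin d) → ℝ, ∀ h : D.IsTestFunction φ, ∀ i : Fin d,
      inner ℝ (((h.continuous_fderiv.clm_apply continuous_const).memLp_of_hasCompactSupport
        (h.hasCompactSupport.fderiv_apply (𝕜 := ℝ) (EuclideanSpace.single i (1 : ℝ)))).toLp _ : D.L2) u =
      - inner ℝ (((h.continuous.smul continuous_const).memLp_of_hasCompactSupport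
        (h.hasCompactSupport.smul_right
          (f' := fun _ => EuclideanSpace.single i (1 : ℝ)))).toLp _ : D.L2Vec) g := by
  refine forall_congr' fun φ => forall_congr' fun h => forall_congr' fun i => ?_
  rw [L2.inner_def, L2.inner_def]
  have e1 : ∫ x in D.carrier, u x * fderiv ℝ φ x (EuclideanSpace.single i 1) =
      ∫ x in D.carrier, inner ℝ ((((h.continuous_fderiv.clm_apply continuous_const).memLp_of_hasCompactSupport
        (h.hasCompactSupport.fderiv_apply (𝕜 := ℝ) (EuclideanSpace.single i (1 : ℝ)))).toLp _ : D.L2) x) (u x) := by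
    refine integral_congr_ae ?_
    filter_upwards [MemLp.coeFn_toLp (((h.continuous_fderiv.clm_apply continuous_const).memLp_of_hasCompactSupport
        (h.hasCompactSupport.fderiv_apply (𝕜 := ℝ) (EuclideanSpace.single i (1 : ℝ)))) :
          MemLp _ 2 D.leb)] with x hx
    rw [hx]
    simp
  have e2 : ∫ x in D.carrier, g x i * φ x =
      ∫ x in D.carrier, inner ℝ ((((h.continuous.smul continuous_const).memLp_of_hasCompactSupport
        (h.hasCompactSupport.smul_right
          (f' := fun _ => EuclideanSpace.single i (1 : ℝ)))).toLp _ : D.L2Vec) x) (g x) := by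
    refine integral_congr_ae ?_
    filter_upwards [MemLp.coeFn_toLp (((h.continuous.smul continuous_const).memLp_of_hasCompactSupport
        (h.hasCompactSupport.smul_right
          (f' := fun _ => EuclideanSpace.single i (1 : ℝ)))) :
          MemLp _ 2 D.leb)] with x hx
    rw [hx]
    simp [inner_smul_left, EuclideanSpace.inner_single_left, mul_comm]
  rw [e1, e2]

variable (D)

/-- `H¹(D)`: the functions of `L²(D)` with a weak gradient in `L²(D; ℝ^d)`, each one stored together
with its (unique) weak gradient, with the product topology, i.e. that of the `H¹` norm. -/
noncomputable def H1 : Submodule ℝ (D.L2 × D.L2Vec) where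
  carrier := {p | D.IsWeakGradient p.1 p.2}
  zero_mem' := by
    simp only [mem_ofPred_eq, isWeakGradient_iff]
    intro φ h i
    simp
  add_mem' := by
    intro p q hp hq
    simp only [mem_ofPred_eq, isWeakGradient_iff] at *
    intro φ h i
    rw [Prod.fst_add, Prod.snd_add, inner_add_right, inner_add_right, hp φ h i, hq φ h i]
    ring
  smul_mem' := by
    intro c p hp
    simp only [mem_ofPred_eq, isWeakGradient_iff] at *
    intro φ h i
    rw [Prod.smul_fst, Prod.smul_snd, inner_smul_right, inner_smul_right, hp φ h i]
    ring

theorem isClosed_H1 : IsClosed (D.H1 : Set (D.L2 × D.L2Vec)) := by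
  have : (D.H1 : Set (D.L2 × D.L2Vec)) = {p | D.IsWeakGradient p.1 p.2} := rfl
  rw [this]
  simp only [isWeakGradient_iff, ofPred_forall]
  refine isClosed_iInter fun φ => isClosed_iInter fun h => isClosed_iInter fun i => ?_
  exact isClosed_eq (by fun_prop) (by fun_prop)

/-- The pairs `(φ, ∇φ)` with `φ ∈ C_c^∞(D)`. -/
noncomputable def testPairs : Submodule ℝ (D.L2 × D.L2Vec) where
  carrier := {p | ∃ φ : EuclideanSpace ℝ (Fin d) → ℝ, D.IsTestFunction φ ∧
    p.1 =ᵐ[D.leb] φ ∧ p.2 =ᵐ[D.leb] gradient φ}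
  zero_mem' := by
    refine ⟨fun _ => 0, ⟨contDiff_const, HasCompactSupport.zero, by simp [tsupport]⟩,
      Lp.coeFn_zero _ _ _, ?_⟩
    have : gradient (fun _ : EuclideanSpace ℝ (Fin d) => (0 : ℝ)) = 0 := by
      ext1 x; simp [gradient]
    rw [this]
    exact Lp.coeFn_zero _ _ _
  add_mem' := by
    rintro p q ⟨φ, h, h1, h2⟩ ⟨ψ, k, k1, k2⟩
    refine ⟨φ + ψ, ⟨h.contDiff.add k.contDiff, h.hasCompactSupport.add k.hasCompactSupport,
      (tsupport_add φ ψ).trans (union_subset h.tsupport_subset k.tsupport_subset)⟩,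
      (Lp.coeFn_add _ _).trans (h1.add k1), ?_⟩
    have : gradient (φ + ψ) = gradient φ + gradient ψ := by
      ext1 x
      simp only [gradient, Pi.add_apply]
      rw [fderiv_add (h.differentiable x) (k.differentiable x), map_add]
    rw [this]
    exact (Lp.coeFn_add _ _).trans (h2.add k2)
  smul_mem' := by
    rintro c p ⟨φ, h, h1, h2⟩
    refine ⟨c • φ, ⟨h.contDiff.const_smul c, h.hasCompactSupport.smul_left (f := fun _ => c),
      (closure_mono (Function.support_const_smul_subset c φ)).trans h.tsupport_subset⟩,
      (Lp.coeFn_smul _ _).trans (h1.const_smul c), ?_⟩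
    have : gradient (c • φ) = c • gradient φ := by
      ext1 x
      simp only [gradient, Pi.smul_apply]
      rw [fderiv_const_smul (h.differentiable x), map_smul]
    rw [this]
    exact (Lp.coeFn_smul _ _).trans (h2.const_smul c)

/-- `H¹₀(D)` inside `H¹(D)`: the closure of `C_c^∞(D)`. -/
noncomputable def H10Submodule : Submodule ℝ (D.L2 × D.L2Vec) :=
  D.H1 ⊓ D.testPairs.topologicalClosure

/-- The space `Y = H¹₀(D)`. A separate type, since it carries the norm `‖∇y‖_{L²(D)}`. -/
def H10 : Type := ↥D.H10Submodule

noncomputable instance : AddCommGroup D.H10 := inferInstanceAs (AddCommGroup ↥D.H10Submodule)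
noncomputable instance : Module ℝ D.H10 := inferInstanceAs (Module ℝ ↥D.H10Submodule)

variable {D}

/-- The underlying function of an element of `H¹₀(D)`. -/
noncomputable def H10.toL2 : D.H10 →ₗ[ℝ] D.L2 :=
  (LinearMap.fst ℝ D.L2 D.L2Vec) ∘ₗ D.H10Submodule.subtype

/-- The (weak) gradient of an element of `H¹₀(D)`. -/
noncomputable def H10.grad : D.H10 →ₗ[ℝ] D.L2Vec :=
  (LinearMap.snd ℝ D.L2 D.L2Vec) ∘ₗ D.H10Submodule.subtype

theorem norm_gradient (φ : EuclideanSpace ℝ (Fin d) → ℝ) (x : EuclideanSpace ℝ (Fin d)) :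
    ‖gradient φ x‖ = ‖fderiv ℝ φ x‖ :=
  LinearIsometryEquiv.norm_map _ _

theorem IsTestFunction.integrable_sq {φ : EuclideanSpace ℝ (Fin d) → ℝ}
    (h : D.IsTestFunction φ) : Integrable (fun x => φ x ^ 2) :=
  (h.continuous.pow 2).integrable_of_hasCompactSupport
    (h.hasCompactSupport.mono fun x hx hx' => hx (by simp [hx']))

theorem IsTestFunction.integrable_gradient_sq {φ : EuclideanSpace ℝ (Fin d) → ℝ}
    (h : D.IsTestFunction φ) : Integrable (fun x => ‖gradient φ x‖ ^ 2) := by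
  simp only [norm_gradient]
  exact (h.continuous_fderiv.norm.pow 2).integrable_of_hasCompactSupport
    ((h.hasCompactSupport.fderiv (𝕜 := ℝ)).mono fun x hx hx' => hx (by simp [hx']))

theorem IsTestFunction.poincare [NeZero d] {φ : EuclideanSpace ℝ (Fin d) → ℝ}
    (h : D.IsTestFunction φ) {R : ℝ} (hDR : ∀ x ∈ D.carrier, ‖x‖ ≤ R) :
    ∫ x in D.carrier, φ x ^ 2 ≤ 4 * R ^ 2 * ∫ x in D.carrier, ‖gradient φ x‖ ^ 2 := by
  have hφ0 : ∀ x, x ∉ D.carrier → φ x = 0 := fun x hx =>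
    image_eq_zero_of_notMem_tsupport fun h' => hx (h.tsupport_subset h')
  have hg0 : ∀ x, x ∉ D.carrier → gradient φ x = 0 := fun x hx => by
    have : fderiv ℝ φ x = 0 := image_eq_zero_of_notMem_tsupport fun h' =>
      hx (h.tsupport_subset (tsupport_fderiv_subset ℝ h'))
    simp [gradient, this]
  rw [setIntegral_eq_integral_of_forall_compl_eq_zero (fun x hx => by rw [hφ0 x hx]; simp),
    setIntegral_eq_integral_of_forall_compl_eq_zero (fun x hx => by rw [hg0 x hx]; simp)]
  have hφc := h.continuous
  have hfc := h.continuous_fderiv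
  have hI1 := h.integrable_sq
  have hI2 := h.integrable_gradient_sq
  let e : EuclideanSpace ℝ (Fin d) := EuclideanSpace.single 0 1
  let L : EuclideanSpace ℝ (Fin d) →L[ℝ] ℝ := innerSL ℝ e
  have hLe : L e = 1 := by simp [L, e]
  have he : ‖e‖ = 1 := by simp [e]
  have hfd : ∀ x, fderiv ℝ (fun x => φ x ^ 2) x e = 2 * φ x * fderiv ℝ φ x e := fun x => by
    rw [fderiv_fun_pow 2 (h.differentiable x)]
    simp
  have hsq : HasCompactSupport (fun x => φ x ^ 2) :=
    h.hasCompactSupport.comp_left (g := fun t : ℝ => t ^ 2) (by simp)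
  have key := integral_mul_fderiv_eq_neg_fderiv_mul_of_integrable (𝕜 := ℝ)
    (f := fun x => φ x ^ 2) (g := fun x => L x) (v := e)
    (μ := (volume : Measure (EuclideanSpace ℝ (Fin d)))) (by
      simp only [hfd]
      exact Continuous.integrable_of_hasCompactSupport (by fun_prop)
        ((h.hasCompactSupport.mul_left (f := fun _ => 2)).mul_right.mul_right)) (by
      simp only [ContinuousLinearMap.fderiv, hLe, mul_one]
      exact hI1) (by
      exact Continuous.integrable_of_hasCompactSupport (by fun_prop) hsq.mul_right)
    (fun x _ => (h.differentiable x).pow 2) (fun x _ => L.differentiableAt)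
  simp only [ContinuousLinearMap.fderiv, hLe, mul_one, hfd] at key
  have hpt : ∀ x, -(2 * φ x * fderiv ℝ φ x e * L x) ≤
      (1 / 2) * φ x ^ 2 + 2 * R ^ 2 * ‖gradient φ x‖ ^ 2 := fun x => by
    by_cases hx : x ∈ D.carrier
    · have h1 : |fderiv ℝ φ x e| ≤ ‖gradient φ x‖ := by
        rw [norm_gradient]
        simpa [he] using (fderiv ℝ φ x).le_opNorm e
      have h2 : |L x| ≤ R := by
        have : |L x| ≤ ‖e‖ * ‖x‖ := abs_real_inner_le_norm e x
        rw [he, one_mul] at this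
        exact this.trans (hDR x hx)
      have h3 : |fderiv ℝ φ x e * L x| ≤ ‖gradient φ x‖ * R := by
        rw [abs_mul]
        exact mul_le_mul h1 h2 (abs_nonneg _) (norm_nonneg _)
      have h4 : -(2 * φ x * fderiv ℝ φ x e * L x) ≤ 2 * |φ x| * (‖gradient φ x‖ * R) := by
        calc -(2 * φ x * fderiv ℝ φ x e * L x) ≤ |2 * φ x * (fderiv ℝ φ x e * L x)| := by
              rw [← mul_assoc]; exact neg_le_abs _
          _ = 2 * |φ x| * |fderiv ℝ φ x e * L x| := by
              rw [abs_mul, abs_mul]; simp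
          _ ≤ _ := by gcongr
      nlinarith [sq_nonneg (|φ x| - 2 * (‖gradient φ x‖ * R)), sq_abs (φ x)]
    · simp [hφ0 x hx]
      positivity
  have hmono : ∫ x, -(2 * φ x * fderiv ℝ φ x e * L x) ≤
      ∫ x, ((1 / 2) * φ x ^ 2 + 2 * R ^ 2 * ‖gradient φ x‖ ^ 2) :=
    integral_mono (Continuous.integrable_of_hasCompactSupport (by fun_prop)
      ((h.hasCompactSupport.mul_left (f := fun _ => 2)).mul_right.mul_right)).neg
      ((hI1.const_mul _).add (hI2.const_mul _)) hpt
  rw [integral_neg, ← key, integral_add (hI1.const_mul _) (hI2.const_mul _),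
    integral_const_mul, integral_const_mul] at hmono
  linarith

variable (D)

/-- The Poincaré inequality. -/
theorem exists_poincare [NeZero d] : ∃ C : ℝ, 0 ≤ C ∧ ∀ u : D.H10, ‖u.toL2‖ ≤ C * ‖u.grad‖ := by
  obtain ⟨R, hR⟩ := D.isBounded.exists_norm_le
  have hR0 : 0 ≤ R := by
    obtain ⟨x, hx⟩ := D.isConnected.nonempty
    exact (norm_nonneg x).trans (hR x hx)
  refine ⟨2 * R, by positivity, ?_⟩
  have hcl : IsClosed {p : D.L2 × D.L2Vec | ‖p.1‖ ≤ 2 * R * ‖p.2‖} :=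
    isClosed_le (by fun_prop) (by fun_prop)
  have hsub : (D.testPairs : Set (D.L2 × D.L2Vec)) ⊆ {p | ‖p.1‖ ≤ 2 * R * ‖p.2‖} := by
    rintro p ⟨φ, h, h1, h2⟩
    have e1 : ‖p.1‖ ^ 2 = ∫ x in D.carrier, φ x ^ 2 := by
      rw [← real_inner_self_eq_norm_sq, L2.inner_def]
      refine integral_congr_ae ?_
      filter_upwards [h1] with x hx
      rw [hx, real_inner_self_eq_norm_sq, Real.norm_eq_abs, sq_abs]
    have e2 : ‖p.2‖ ^ 2 = ∫ x in D.carrier, ‖gradient φ x‖ ^ 2 := by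
      rw [← real_inner_self_eq_norm_sq, L2.inner_def]
      refine integral_congr_ae ?_
      filter_upwards [h2] with x hx
      rw [hx, real_inner_self_eq_norm_sq]
    have := h.poincare hR
    rw [← e1, ← e2] at this
    refine (sq_le_sq₀ (norm_nonneg _) (by positivity)).1 ?_
    calc ‖p.1‖ ^ 2 ≤ 4 * R ^ 2 * ‖p.2‖ ^ 2 := this
      _ = (2 * R * ‖p.2‖) ^ 2 := by ring
  intro u
  exact closure_minimal hsub hcl u.2.2

/-- The inner product `(u, v) ↦ ∫_D ∇u · ∇v` of `H¹₀(D)`. -/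
noncomputable abbrev H10.core [NeZero d] : InnerProductSpace.Core ℝ D.H10 where
  inner u v := inner ℝ u.grad v.grad
  conj_inner_symm u v := by simp [real_inner_comm]
  re_inner_nonneg u := by simp
  add_left u v w := by rw [map_add, inner_add_left]
  smul_left u v r := by rw [map_smul, inner_smul_left]
  definite u hu := by
    have hg : u.grad = 0 := inner_self_eq_zero.1 hu
    obtain ⟨C, -, hC⟩ := D.exists_poincare
    have h0 : u.toL2 = 0 := by
      have := hC u
      rw [hg, norm_zero, mul_zero] at this
      exact norm_le_zero_iff.1 this
    exact Subtype.ext (Prod.ext h0 hg)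

noncomputable instance [NeZero d] : NormedAddCommGroup D.H10 :=
  (H10.core D).toNormedAddCommGroup

noncomputable instance [NeZero d] : InnerProductSpace ℝ D.H10 :=
  InnerProductSpace.ofCore (H10.core D).toCore

variable {D}

theorem H10.inner_def [NeZero d] (u v : D.H10) : inner ℝ u v = inner ℝ u.grad v.grad := rfl

theorem H10.norm_def [NeZero d] (u : D.H10) : ‖u‖ = ‖u.grad‖ := by
  rw [@norm_eq_sqrt_real_inner D.H10, @norm_eq_sqrt_real_inner D.L2Vec, H10.inner_def]

/-- `H¹₀(D)` is complete, so that the Bochner integral of `H¹₀(D)`-valued functions is the genuine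
one. -/
instance [NeZero d] : CompleteSpace D.H10 := by
  obtain ⟨C, hC0, hC⟩ := D.exists_poincare
  have hcl : IsClosed (D.H10Submodule : Set (D.L2 × D.L2Vec)) :=
    D.isClosed_H1.inter D.testPairs.isClosed_topologicalClosure
  have : CompleteSpace ↥D.H10Submodule := hcl.completeSpace_coe
  let e : D.H10 ≃ₗ[ℝ] ↥D.H10Submodule := LinearEquiv.refl ℝ ↥D.H10Submodule
  have he : ∀ u : D.H10, ‖e u‖ = max ‖u.toL2‖ ‖u.grad‖ := fun u => rfl
  let E := e.toContinuousLinearEquivOfBounds (max C 1) 1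
    (fun u => by
      rw [he, H10.norm_def]
      refine max_le ((hC u).trans ?_) ?_
      · gcongr
        exact le_max_left _ _
      · exact le_mul_of_one_le_left (norm_nonneg _) (le_max_right _ _))
    (fun w => by
      rw [one_mul, H10.norm_def]
      have := he (e.symm w)
      rw [e.apply_symm_apply] at this
      rw [this]
      exact le_max_right _ _)
  exact (completeSpace_congr (e := E.toEquiv) E.isUniformEmbedding).2 this

end Sobolev

section Form

variable {d : ℕ} (D : BoundedDomain d)

instance : CompactSpace ↥(closure D.carrier) :=
  isCompact_iff_compactSpace.1 D.isBounded.isCompact_closure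

instance : Nonempty ↥(closure D.carrier) :=
  D.isConnected.nonempty.closure.to_subtype

/-- `C⁰(D̄)` carries its Borel σ-algebra. -/
instance : MeasurableSpace C(↥(closure D.carrier), ℝ) := borel _

instance : BorelSpace C(↥(closure D.carrier), ℝ) := ⟨rfl⟩

variable {D}

open Classical in
/-- A function on `D̄`, extended by `0` to `ℝ^d`. -/
noncomputable def extend (k : C(↥(closure D.carrier), ℝ)) (x : EuclideanSpace ℝ (Fin d)) : ℝ :=
  if h : x ∈ closure D.carrier then k ⟨x, h⟩ else 0

/-- `min_{x ∈ D̄} k(x)`. -/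
noncomputable def minValue (k : C(↥(closure D.carrier), ℝ)) : ℝ := ⨅ x, k x

/-- `max_{x ∈ D̄} k(x)`. -/
noncomputable def maxValue (k : C(↥(closure D.carrier), ℝ)) : ℝ := ⨆ x, k x

/-- The bilinear form `∫_D k ∇u · ∇v` on `H¹₀(D)`. -/
noncomputable def form (k : C(↥(closure D.carrier), ℝ)) (u v : D.H10) : ℝ :=
  ∫ x in D.carrier, extend k x * inner ℝ (u.grad x) (v.grad x)

theorem extend_of_mem (k : C(↥(closure D.carrier), ℝ)) {x : EuclideanSpace ℝ (Fin d)}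
    (hx : x ∈ D.carrier) : extend k x = k ⟨x, subset_closure hx⟩ := by
  rw [extend, dif_pos]

theorem ae_mem_carrier : ∀ᵐ x ∂D.leb, x ∈ D.carrier :=
  ae_restrict_mem D.isOpen.measurableSet

theorem abs_extend_le (k : C(↥(closure D.carrier), ℝ)) (x : EuclideanSpace ℝ (Fin d)) :
    ‖extend k x‖ ≤ ‖k‖ := by
  rw [extend]
  split_ifs
  · exact k.norm_coe_le_norm _
  · simp

theorem aestronglyMeasurable_extend (k : C(↥(closure D.carrier), ℝ)) :
    AEStronglyMeasurable (extend k) D.leb := by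
  refine ContinuousOn.aestronglyMeasurable ?_ D.isOpen.measurableSet
  rw [continuousOn_iff_continuous_domRestrict]
  have : D.carrier.domRestrict (extend k) =
      fun x : D.carrier => k ⟨x.1, subset_closure x.2⟩ := by
    ext x
    exact extend_of_mem k x.2
  rw [this]
  fun_prop

theorem memLp_extend_smul (k : C(↥(closure D.carrier), ℝ)) (g : D.L2Vec) :
    MemLp (fun x => extend k x • g x) 2 D.leb :=
  (Lp.memLp g).of_le_mul (c := ‖k‖) ((aestronglyMeasurable_extend k).smul
    (Lp.aestronglyMeasurable g)) (.of_forall fun x => by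
      rw [norm_smul]
      gcongr
      exact abs_extend_le k x)

/-- Multiplication of a field of `L²(D; ℝ^d)` by a function of `C⁰(D̄)`. -/
noncomputable def mulL :
    C(↥(closure D.carrier), ℝ) →L[ℝ] D.L2Vec →L[ℝ] D.L2Vec :=
  LinearMap.mkContinuous₂
    (LinearMap.mk₂ ℝ (fun k g => (memLp_extend_smul k g).toLp _)
      (fun k l g => by
        rw [← MemLp.toLp_add]
        refine MemLp.toLp_congr _ _ ?_
        filter_upwards [ae_mem_carrier] with x hx
        simp [extend_of_mem _ hx, add_smul])
      (fun c k g => by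
        rw [← MemLp.toLp_const_smul]
        refine MemLp.toLp_congr _ _ ?_
        filter_upwards [ae_mem_carrier] with x hx
        simp [extend_of_mem _ hx, mul_smul])
      (fun k g h => by
        rw [← MemLp.toLp_add]
        refine MemLp.toLp_congr _ _ ?_
        filter_upwards [Lp.coeFn_add g h] with x hx
        rw [hx, Pi.add_apply, smul_add, Pi.add_apply])
      (fun c k g => by
        rw [← MemLp.toLp_const_smul]
        refine MemLp.toLp_congr _ _ ?_
        filter_upwards [Lp.coeFn_smul c g] with x hx
        rw [hx, Pi.smul_apply, Pi.smul_apply, smul_comm])) 1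
    (fun k g => by
      rw [one_mul]
      refine Lp.norm_le_mul_norm_of_ae_le_mul ?_
      filter_upwards [(memLp_extend_smul k g).coeFn_toLp] with x hx
      rw [LinearMap.mk₂_apply, hx, norm_smul]
      gcongr
      exact abs_extend_le k x)

theorem form_eq (k : C(↥(closure D.carrier), ℝ)) (u v : D.H10) :
    form k u v = inner ℝ (mulL k u.grad) v.grad := by
  rw [L2.inner_def]
  refine integral_congr_ae ?_
  filter_upwards [(memLp_extend_smul k u.grad).coeFn_toLp] with x hx
  change _ = inner ℝ ((memLp_extend_smul k u.grad).toLp _ x) _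
  rw [hx, real_inner_smul_left]

theorem form_comm (k : C(↥(closure D.carrier), ℝ)) (u v : D.H10) : form k u v = form k v u := by
  simp only [form, real_inner_comm]

theorem form_add_left (k : C(↥(closure D.carrier), ℝ)) (u v w : D.H10) :
    form k (u + v) w = form k u w + form k v w := by
  simp only [form_eq, map_add, inner_add_left]

theorem form_smul_left (k : C(↥(closure D.carrier), ℝ)) (c : ℝ) (u w : D.H10) :
    form k (c • u) w = c * form k u w := by
  simp only [form_eq, map_smul, real_inner_smul_left]

theorem form_add_right (k : C(↥(closure D.carrier), ℝ)) (u v w : D.H10) :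
    form k u (v + w) = form k u v + form k u w := by
  simp only [form_eq, map_add, inner_add_right]

theorem form_smul_right (k : C(↥(closure D.carrier), ℝ)) (c : ℝ) (u w : D.H10) :
    form k u (c • w) = c * form k u w := by
  simp only [form_eq, map_smul, real_inner_smul_right]

variable [NeZero d]

/-- The coercivity of the form. -/
theorem minValue_mul_le_form (k : C(↥(closure D.carrier), ℝ)) (u : D.H10) :
    minValue k * ‖u‖ ^ 2 ≤ form k u u := by
  rw [H10.norm_def, ← real_inner_self_eq_norm_sq, L2.inner_def, ← integral_const_mul]
  have hi := L2.integrable_inner (𝕜 := ℝ) u.grad u.grad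
  refine integral_mono_ae (hi.const_mul _)
    (hi.bdd_mul (aestronglyMeasurable_extend k) (.of_forall (abs_extend_le k))) ?_
  filter_upwards [ae_mem_carrier] with x hx
  rw [extend_of_mem k hx]
  refine mul_le_mul_of_nonneg_right ?_ real_inner_self_nonneg
  exact ciInf_le (isCompact_range k.continuous).bddBelow _

theorem minValue_pos {k : C(↥(closure D.carrier), ℝ)} (hk : ∀ x, 0 < k x) : 0 < minValue k := by
  obtain ⟨x, -, hx⟩ := isCompact_univ.exists_isMinOn univ_nonempty k.continuous.continuousOn
  exact (hk x).trans_le (le_ciInf fun y => hx (mem_univ y))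

theorem H10.continuous_grad : Continuous (H10.grad : D.H10 → D.L2Vec) :=
  AddMonoidHomClass.continuous_of_bound (H10.grad : D.H10 →ₗ[ℝ] D.L2Vec) 1
    (fun u => by rw [one_mul, H10.norm_def])

theorem continuous_form : Continuous
    fun p : C(↥(closure D.carrier), ℝ) × D.H10 × D.H10 => form p.1 p.2.1 p.2.2 := by
  simp only [form_eq]
  have h := H10.continuous_grad (D := D)
  fun_prop

end Form

section Energy

variable {d : ℕ} [NeZero d] (D : BoundedDomain d) {Ω : Type*} [MeasurableSpace Ω] (P : Measure Ω)

/-- A random diffusion field on `D`: a measurable map into `C⁰(D̄)` with almost surely positive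
realizations such that, for some `p ∈ [1, ∞]`, both `ω ↦ max_D̄ κ(·, ω)` and
`ω ↦ 1 / min_D̄ κ(·, ω)` are in `L^p(Ω)`. -/
structure DiffusionField where
  toFun : Ω → C(↥(closure D.carrier), ℝ)
  measurable : Measurable toFun
  pos : ∀ᵐ ω ∂P, ∀ x, 0 < toFun ω x
  exists_memLp : ∃ p : ℝ≥0∞, 1 ≤ p ∧ MemLp (fun ω => maxValue (toFun ω)) p P ∧
    MemLp (fun ω => 1 / minValue (toFun ω)) p P

variable {D P} [IsProbabilityMeasure P] (κ : D.DiffusionField P)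

namespace DiffusionField

theorem aestronglyMeasurable_form (u v : Ω →ₘ[P] D.H10) :
    AEStronglyMeasurable (fun ω => form (κ.toFun ω) (u ω) (v ω)) P :=
  continuous_form.comp_aestronglyMeasurable
    (κ.measurable.stronglyMeasurable.aestronglyMeasurable.prodMk
      (u.aestronglyMeasurable.prodMk v.aestronglyMeasurable))

theorem ae_minValue_pos : ∀ᵐ ω ∂P, 0 < minValue (κ.toFun ω) := by
  filter_upwards [κ.pos] with ω h using minValue_pos h

theorem ae_form_nonneg : ∀ᵐ ω ∂P, ∀ u : D.H10, 0 ≤ form (κ.toFun ω) u u := by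
  filter_upwards [κ.ae_minValue_pos] with ω h u
  exact (by positivity : 0 ≤ _ * ‖u‖ ^ 2).trans (minValue_mul_le_form _ u)

theorem integrable_inv : Integrable (fun ω => 1 / minValue (κ.toFun ω)) P := by
  obtain ⟨p, hp, -, h⟩ := κ.exists_memLp
  exact h.integrable hp

/-- The measurable functions `v : Ω → H¹₀(D)`, up to almost sure equality, such that
`a(v, v) = E[∫_D κ(·, ω) |∇v_ω|²]` is finite. -/
noncomputable def energySubmodule : Submodule ℝ (Ω →ₘ[P] D.H10) where
  carrier := {v | Integrable (fun ω => form (κ.toFun ω) (v ω) (v ω)) P}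
  zero_mem' := by
    refine (integrable_zero Ω ℝ P).congr ?_
    filter_upwards [AEEqFun.coeFn_zero (α := Ω) (β := D.H10) (μ := P)] with ω h
    simp [h, form_eq]
  add_mem' := by
    intro u v hu hv
    refine ((hu.const_mul 2).add (hv.const_mul 2)).mono' (κ.aestronglyMeasurable_form _ _) ?_
    filter_upwards [AEEqFun.coeFn_add u v, κ.ae_form_nonneg] with ω h hn
    rw [Real.norm_of_nonneg (hn _), h]
    have := hn (u ω + (-1 : ℝ) • v ω)
    simp only [Pi.add_apply, form_add_left, form_add_right, form_smul_left, form_smul_right]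
      at this ⊢
    linarith
  smul_mem' := by
    intro c v hv
    refine (hv.const_mul (c ^ 2)).congr ?_
    filter_upwards [AEEqFun.coeFn_smul c v] with ω h
    rw [h]
    simp only [Pi.smul_apply, form_smul_left, form_smul_right]
    ring

/-- The energy space. A separate type, since it carries the norm `‖v‖² = a(v, v)`. -/
def EnergySpace : Type _ := ↥κ.energySubmodule

noncomputable instance : AddCommGroup κ.EnergySpace :=
  inferInstanceAs (AddCommGroup ↥κ.energySubmodule)
noncomputable instance : Module ℝ κ.EnergySpace := inferInstanceAs (Module ℝ ↥κ.energySubmodule)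

variable {κ}

/-- The `H¹₀(D)`-valued random variable (up to almost sure equality) given by an element of the
energy space. -/
noncomputable def EnergySpace.toAEEqFun : κ.EnergySpace →ₗ[ℝ] (Ω →ₘ[P] D.H10) :=
  κ.energySubmodule.subtype

noncomputable instance : CoeFun κ.EnergySpace (fun _ => Ω → D.H10) := ⟨fun v => v.toAEEqFun⟩

theorem EnergySpace.coe_add (u v : κ.EnergySpace) : ⇑(u + v).toAEEqFun =ᵐ[P] fun ω => u ω + v ω := by
  rw [map_add]
  exact AEEqFun.coeFn_add _ _

theorem EnergySpace.coe_smul (c : ℝ) (v : κ.EnergySpace) :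
    ⇑(c • v).toAEEqFun =ᵐ[P] fun ω => c • v ω := by
  rw [map_smul]
  exact AEEqFun.coeFn_smul _ _

theorem EnergySpace.integrable_self (v : κ.EnergySpace) :
    Integrable (fun ω => form (κ.toFun ω) (v ω) (v ω)) P := v.2

theorem EnergySpace.integrable_form (u v : κ.EnergySpace) :
    Integrable (fun ω => form (κ.toFun ω) (u ω) (v ω)) P := by
  refine (u.integrable_self.add v.integrable_self).mono' (κ.aestronglyMeasurable_form _ _) ?_
  filter_upwards [κ.ae_form_nonneg] with ω hn
  have h1 := hn (u ω + (-1 : ℝ) • v ω)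
  have h2 := hn (u ω + v ω)
  have h3 := form_comm (κ.toFun ω) (v ω) (u ω)
  have h4 := hn (u ω)
  have h5 := hn (v ω)
  simp only [form_add_left, form_add_right, form_smul_left, form_smul_right, Pi.add_apply]
    at h1 h2 ⊢
  rw [Real.norm_eq_abs, abs_le]
  constructor <;> linarith

variable (κ) in
/-- The energy inner product `a(u, v) = E[∫_D κ(·, ω) ∇u_ω · ∇v_ω]`. -/
noncomputable abbrev EnergySpace.core : InnerProductSpace.Core ℝ κ.EnergySpace where
  inner u v := ∫ ω, form (κ.toFun ω) (u ω) (v ω) ∂P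
  conj_inner_symm u v := by
    simp only [conj_trivial]
    exact integral_congr_ae (.of_forall fun ω => form_comm _ _ _)
  re_inner_nonneg u := by
    refine integral_nonneg_of_ae ?_
    filter_upwards [κ.ae_form_nonneg] with ω h using h _
  add_left u v w := by
    rw [← integral_add (u.integrable_form w) (v.integrable_form w)]
    refine integral_congr_ae ?_
    filter_upwards [EnergySpace.coe_add u v] with ω h
    rw [h, form_add_left]
  smul_left u v c := by
    rw [conj_trivial, ← integral_const_mul]
    refine integral_congr_ae ?_
    filter_upwards [EnergySpace.coe_smul c u] with ω h
    rw [h, form_smul_left]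
  definite u hu := by
    have h0 := (integral_eq_zero_iff_of_nonneg_ae
      (by filter_upwards [κ.ae_form_nonneg] with ω h using h _) u.integrable_self).1 hu
    refine Subtype.ext (AEEqFun.ext ?_)
    filter_upwards [h0, κ.ae_minValue_pos, AEEqFun.coeFn_zero (α := Ω) (β := D.H10) (μ := P)]
      with ω h1 h2 h3
    have h4 := minValue_mul_le_form (κ.toFun ω) (u ω)
    rw [h1, Pi.zero_apply] at h4
    have h5 : ‖u ω‖ ^ 2 ≤ 0 := nonpos_of_mul_nonpos_right h4 h2
    have h6 : u ω = 0 := by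
      rw [← norm_eq_zero]
      exact pow_eq_zero_iff two_ne_zero |>.1 (le_antisymm h5 (sq_nonneg _))
    exact h6.trans h3.symm

noncomputable instance : NormedAddCommGroup κ.EnergySpace :=
  (EnergySpace.core κ).toNormedAddCommGroup

noncomputable instance : InnerProductSpace ℝ κ.EnergySpace :=
  InnerProductSpace.ofCore (EnergySpace.core κ).toCore

theorem EnergySpace.norm_sq (v : κ.EnergySpace) :
    ‖v‖ ^ 2 = ∫ ω, form (κ.toFun ω) (v ω) (v ω) ∂P := by
  rw [← real_inner_self_eq_norm_sq]
  rfl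

theorem EnergySpace.ae_norm_le (v : κ.EnergySpace) {t : ℝ} (ht : 0 < t) : ∀ᵐ ω ∂P,
    ‖v ω‖ ≤ t * (1 / minValue (κ.toFun ω)) + (1 / t) * form (κ.toFun ω) (v ω) (v ω) := by
  filter_upwards [κ.ae_minValue_pos] with ω h
  have h4 := minValue_mul_le_form (κ.toFun ω) (v ω)
  set m := minValue (κ.toFun ω)
  calc ‖v ω‖ ≤ t * (1 / m) + (1 / t) * (m * ‖v ω‖ ^ 2) := by
        have e : t * (1 / m) + (1 / t) * (m * ‖v ω‖ ^ 2) =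
          (t ^ 2 + (m * ‖v ω‖) ^ 2) / (t * m) := by field_simp
        rw [e, le_div_iff₀ (by positivity)]
        nlinarith [sq_nonneg (t - m * ‖v ω‖), norm_nonneg (v ω),
          mul_nonneg (mul_nonneg ht.le h.le) (norm_nonneg (v ω))]
    _ ≤ _ := by gcongr

/-- Elements of the energy space are Bochner integrable. -/
theorem EnergySpace.integrable (v : κ.EnergySpace) : Integrable (fun ω => v ω) P := by
  refine ((κ.integrable_inv.const_mul 1).add (v.integrable_self.const_mul (1 / 1))).mono'
    v.toAEEqFun.aestronglyMeasurable ?_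
  exact v.ae_norm_le one_pos

theorem EnergySpace.integral_norm_le (v : κ.EnergySpace) :
    ∫ ω, ‖v ω‖ ∂P ≤ (∫ ω, 1 / minValue (κ.toFun ω) ∂P + 1) * ‖v‖ := by
  rcases eq_or_ne v 0 with rfl | hv
  · have : ∫ ω, ‖(0 : κ.EnergySpace) ω‖ ∂P = 0 := by
      rw [← integral_zero Ω ℝ (μ := P)]
      refine integral_congr_ae ?_
      rw [map_zero]
      filter_upwards [AEEqFun.coeFn_zero (α := Ω) (β := D.H10) (μ := P)] with ω h
      rw [h, Pi.zero_apply, norm_zero]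
    rw [this, norm_zero, mul_zero]
  · have hv' : 0 < ‖v‖ := norm_pos_iff.2 hv
    refine (integral_mono_ae v.integrable.norm ((κ.integrable_inv.const_mul _).add
      (v.integrable_self.const_mul _)) (v.ae_norm_le hv')).trans_eq ?_
    simp only [Pi.add_apply]
    rw [integral_add (κ.integrable_inv.const_mul _) (v.integrable_self.const_mul _),
      integral_const_mul, integral_const_mul, ← v.norm_sq]
    field_simp

variable (κ)

/-- The constant-extension operator `𝓘 f = (v ↦ E[⟨f, v_ω⟩])`, from the dual of `H¹₀(D)` to the
dual of the energy space. -/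
noncomputable def constExt :
    StrongDual ℝ D.H10 →ₗ[ℝ] StrongDual ℝ κ.EnergySpace where
  toFun f := LinearMap.mkContinuous
    { toFun := fun v => ∫ ω, f (v ω) ∂P
      map_add' := fun u v => by
        rw [← integral_add (f.integrable_comp u.integrable) (f.integrable_comp v.integrable)]
        refine integral_congr_ae ?_
        filter_upwards [EnergySpace.coe_add u v] with ω h
        rw [h, map_add]
      map_smul' := fun c v => by
        rw [RingHom.id_apply, smul_eq_mul, ← integral_const_mul]
        refine integral_congr_ae ?_
        filter_upwards [EnergySpace.coe_smul c v] with ω h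
        rw [h, map_smul, smul_eq_mul] }
    (‖f‖ * (∫ ω, 1 / minValue (κ.toFun ω) ∂P + 1))
    (fun v => by
      refine (norm_integral_le_of_norm_le (v.integrable.norm.const_mul ‖f‖)
        (.of_forall fun ω => f.le_opNorm _)).trans ?_
      rw [integral_const_mul, mul_assoc]
      exact mul_le_mul_of_nonneg_left v.integral_norm_le f.opNorm_nonneg)
  map_add' f g := by
    ext v
    exact integral_add (f.integrable_comp v.integrable) (g.integrable_comp v.integrable)
  map_smul' c f := by
    ext v
    exact integral_const_mul _ _

/-- The subspace `G` of the elements `v` of the energy space with zero mean, `E[v_ω] = 0` in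
`H¹₀(D)` (Bochner integral). -/
noncomputable def zeroMean : Submodule ℝ κ.EnergySpace where
  carrier := {v | ∫ ω, v ω ∂P = 0}
  zero_mem' := by
    simp only [mem_ofPred_eq, map_zero]
    rw [integral_congr_ae (AEEqFun.coeFn_zero (α := Ω) (β := D.H10) (μ := P))]
    simp
  add_mem' := by
    intro u v hu hv
    simp only [mem_ofPred_eq] at *
    rw [integral_congr_ae (EnergySpace.coe_add u v), integral_add u.integrable v.integrable, hu,
      hv, add_zero]
  smul_mem' := by
    intro c v hv
    simp only [mem_ofPred_eq] at *
    rw [integral_congr_ae (EnergySpace.coe_smul c v), integral_smul, hv, smul_zero]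

/-- The polar space `G⁰`: the continuous linear functionals on the energy space that vanish
on `G`. -/
noncomputable def polarZeroMean : Submodule ℝ (StrongDual ℝ κ.EnergySpace) where
  carrier := {F | ∀ v ∈ κ.zeroMean, F v = 0}
  zero_mem' := fun v _ => rfl
  add_mem' := fun {F H} hF hH v hv => by simp [hF v hv, hH v hv]
  smul_mem' := fun c F hF v hv => by simp [hF v hv]

end DiffusionField

end Energy

end BoundedDomain

/-!
A functional commutes with the Bochner integral, so `𝓘 f = f ∘ E` is the transpose of the
expectation `E : H_𝒜 → H¹₀(D)`, whose kernel is `G` (`mean`, `constExt_eq_comp_mean`). The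
expectation is continuous by the integrability of `1 / κ_min`. It has a continuous right inverse
`J : H¹₀(D) → H_𝒜`, which views `y` as a constant random variable (`constEmbed`): such a variable has
finite energy because `κ_max` is integrable, and its mean is `y` because `P` has total mass one.

Hence `F ↦ F ∘ J` inverts `𝓘` on `G⁰`. On one side `f ∘ E ∘ J = f`. On the other, every `v` differs
from `J (E v)` by an element of `G` (`sub_constEmbed_mean_mem_zeroMean`), so `F ∘ J ∘ E = F` for
`F ∈ G⁰` (`constExt_comp_constEmbed`). Both maps are precompositions with continuous linear maps,
hence continuous.
-/

namespace BoundedDomain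

variable {d : ℕ} {D : BoundedDomain d}

theorem le_maxValue (k : C(↥(closure D.carrier), ℝ)) (x : ↥(closure D.carrier)) :
    k x ≤ maxValue k :=
  le_ciSup (isCompact_range k.continuous).bddAbove x

namespace DiffusionField

variable {Ω : Type*} [MeasurableSpace Ω] {P : Measure Ω} (κ : D.DiffusionField P)

theorem integral_maxValue_nonneg : 0 ≤ ∫ ω, maxValue (κ.toFun ω) ∂P := by
  refine integral_nonneg_of_ae ?_
  filter_upwards [κ.pos] with ω h
  obtain ⟨x⟩ := (inferInstance : Nonempty ↥(closure D.carrier))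
  exact (h x).le.trans (le_maxValue _ x)

theorem integrable_maxValue [IsProbabilityMeasure P] : Integrable (fun ω => maxValue (κ.toFun ω)) P := by
  obtain ⟨p, hp, h, -⟩ := κ.exists_memLp
  exact h.integrable hp

end DiffusionField

variable [NeZero d]

/-- The boundedness of the form. -/
theorem form_le_maxValue_mul (k : C(↥(closure D.carrier), ℝ)) (u : D.H10) :
    form k u u ≤ maxValue k * ‖u‖ ^ 2 := by
  rw [H10.norm_def, ← real_inner_self_eq_norm_sq, L2.inner_def, ← integral_const_mul]
  have hi := L2.integrable_inner (𝕜 := ℝ) u.grad u.grad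
  refine integral_mono_ae
    (hi.bdd_mul (aestronglyMeasurable_extend k) (.of_forall (abs_extend_le k))) (hi.const_mul _) ?_
  filter_upwards [ae_mem_carrier] with x hx
  rw [extend_of_mem k hx]
  exact mul_le_mul_of_nonneg_right (le_maxValue k _) real_inner_self_nonneg

namespace DiffusionField

variable {Ω : Type*} [MeasurableSpace Ω] {P : Measure Ω} [IsProbabilityMeasure P]
  (κ : D.DiffusionField P)

theorem const_mem_energySubmodule (y : D.H10) :
    (AEEqFun.const Ω y : Ω →ₘ[P] D.H10) ∈ κ.energySubmodule := by
  refine (κ.integrable_maxValue.mul_const (‖y‖ ^ 2)).mono' (κ.aestronglyMeasurable_form _ _) ?_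
  filter_upwards [AEEqFun.coeFn_const Ω y (μ := P), κ.ae_form_nonneg] with ω h hn
  rw [Real.norm_of_nonneg (hn _), h]
  exact form_le_maxValue_mul _ _

/-- An element of `H¹₀(D)` as a constant random variable, a linear map into the energy space. -/
noncomputable def constEmbedₗ : D.H10 →ₗ[ℝ] κ.EnergySpace where
  toFun y := (⟨AEEqFun.const Ω y, κ.const_mem_energySubmodule y⟩ : ↥κ.energySubmodule)
  map_add' _ _ := rfl
  map_smul' _ _ := rfl

theorem coe_constEmbedₗ (y : D.H10) : ⇑(κ.constEmbedₗ y).toAEEqFun =ᵐ[P] fun _ => y :=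
  AEEqFun.coeFn_const Ω y

theorem norm_constEmbedₗ_le (y : D.H10) :
    ‖κ.constEmbedₗ y‖ ≤ √(∫ ω, maxValue (κ.toFun ω) ∂P) * ‖y‖ := by
  refine (sq_le_sq₀ (norm_nonneg _) (by positivity)).1 ?_
  rw [mul_pow, Real.sq_sqrt κ.integral_maxValue_nonneg, EnergySpace.norm_sq,
    ← integral_mul_const]
  refine integral_mono_ae (κ.constEmbedₗ y).integrable_self
    (κ.integrable_maxValue.mul_const _) ?_
  filter_upwards [κ.coe_constEmbedₗ y] with ω h
  rw [h]
  exact form_le_maxValue_mul _ _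

/-- The continuous linear embedding of `H¹₀(D)` into the energy space as the constant random
variables. -/
noncomputable def constEmbed : D.H10 →L[ℝ] κ.EnergySpace :=
  κ.constEmbedₗ.mkContinuous _ κ.norm_constEmbedₗ_le

theorem coe_constEmbed (y : D.H10) : ⇑(κ.constEmbed y).toAEEqFun =ᵐ[P] fun _ => y :=
  κ.coe_constEmbedₗ y

theorem integral_constEmbed (y : D.H10) : ∫ ω, κ.constEmbed y ω ∂P = y := by
  rw [integral_congr_ae (κ.coe_constEmbed y)]
  simp

/-- The expectation `v ↦ E[v_ω]`, a continuous linear map from the energy space to `H¹₀(D)`. -/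
noncomputable def mean : κ.EnergySpace →L[ℝ] D.H10 :=
  LinearMap.mkContinuous
    { toFun := fun v => ∫ ω, v ω ∂P
      map_add' := fun u v => by
        rw [← integral_add u.integrable v.integrable]
        exact integral_congr_ae (EnergySpace.coe_add u v)
      map_smul' := fun c v => by
        rw [RingHom.id_apply, ← integral_smul]
        exact integral_congr_ae (EnergySpace.coe_smul c v) }
    (∫ ω, 1 / minValue (κ.toFun ω) ∂P + 1)
    fun v => (norm_integral_le_integral_norm _).trans v.integral_norm_le

theorem mean_constEmbed (y : D.H10) : κ.mean (κ.constEmbed y) = y :=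
  κ.integral_constEmbed y

/-- A functional commutes with the Bochner integral, so `𝓘` is the transpose of the expectation. -/
theorem constExt_eq_comp_mean (f : StrongDual ℝ D.H10) : κ.constExt f = f.comp κ.mean := by
  ext v
  exact f.integral_comp_comm v.integrable

theorem constExt_mem_polarZeroMean (f : StrongDual ℝ D.H10) :
    κ.constExt f ∈ κ.polarZeroMean := by
  intro v hv
  have hv : κ.mean v = 0 := hv
  rw [constExt_eq_comp_mean, ContinuousLinearMap.comp_apply, hv, map_zero]

theorem sub_constEmbed_mean_mem_zeroMean (v : κ.EnergySpace) :
    v - κ.constEmbed (κ.mean v) ∈ κ.zeroMean := by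
  change κ.mean (v - κ.constEmbed (κ.mean v)) = 0
  rw [map_sub, mean_constEmbed, sub_self]

theorem constExt_comp_constEmbed {F : StrongDual ℝ κ.EnergySpace} (hF : F ∈ κ.polarZeroMean) :
    κ.constExt (F.comp κ.constEmbed) = F := by
  ext v
  have h := hF _ (κ.sub_constEmbed_mean_mem_zeroMean v)
  rw [map_sub, sub_eq_zero] at h
  rw [constExt_eq_comp_mean, h]
  rfl

/-- The operator `𝓘` as a continuous linear map from `H¹₀(D)⋆` to `G⁰`. -/
noncomputable def constExtCLM : StrongDual ℝ D.H10 →L[ℝ] κ.polarZeroMean :=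
  (ContinuousLinearMap.precomp ℝ κ.mean).codRestrict κ.polarZeroMean fun f => by
    rw [ContinuousLinearMap.precomp_apply, ← constExt_eq_comp_mean]
    exact κ.constExt_mem_polarZeroMean f

theorem coe_constExtCLM (f : StrongDual ℝ D.H10) :
    (κ.constExtCLM f : StrongDual ℝ κ.EnergySpace) = κ.constExt f :=
  (κ.constExt_eq_comp_mean f).symm

/-- The restriction of functionals in `G⁰` to the constant random variables. -/
noncomputable def restrictConst : κ.polarZeroMean →L[ℝ] StrongDual ℝ D.H10 :=
  (ContinuousLinearMap.precomp ℝ κ.constEmbed).comp κ.polarZeroMean.subtypeL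

theorem restrictConst_apply (F : κ.polarZeroMean) :
    κ.restrictConst F = (F : StrongDual ℝ κ.EnergySpace).comp κ.constEmbed :=
  rfl

/-- The operator `𝓘` as an isomorphism of `H¹₀(D)⋆` onto `G⁰`. -/
noncomputable def constExtEquiv : StrongDual ℝ D.H10 ≃L[ℝ] κ.polarZeroMean :=
  ContinuousLinearEquiv.equivOfInverse κ.constExtCLM κ.restrictConst
    (fun f => by
      ext y
      rw [restrictConst_apply, coe_constExtCLM, constExt_eq_comp_mean]
      exact congrArg f (κ.mean_constEmbed y))
    (fun F => Subtype.ext <| by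
      rw [coe_constExtCLM, restrictConst_apply, κ.constExt_comp_constEmbed F.2])

end DiffusionField

end BoundedDomain

theorem lemma6p1 {d : ℕ} [NeZero d] (D : BoundedDomain d) {Ω : Type*} [MeasurableSpace Ω]
    (P : Measure Ω) [IsProbabilityMeasure P] (κ : D.DiffusionField P) :
    ∃ T : StrongDual ℝ D.H10 ≃L[ℝ] κ.polarZeroMean,
      ∀ f : StrongDual ℝ D.H10, (T f : StrongDual ℝ κ.EnergySpace) = κ.constExt f := by
  exact ⟨κ.constExtEquiv, κ.coe_constExtCLM⟩
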